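/- Let $B$ be a unital C*-algebra, let $\{A_i\}_{i\in I}$ be a family of unital C*-algebras indexed by an arbitrary set $I$, and let $\varepsilon_i : B \to A_i$ be faithful (injective) unital $*$-homomorphisms. Let $\ast_B A_i$ be the $*$-algebraic amalgamated free product of the $A_i$ over $B$: the unital complex $*$-algebra generated by copies of the $A_i$ (with common unit), subject only to the relations of each $A_i$ and to the identification of the copies $\varepsilon_i(B)$ of $B$. Let $\check{\ast}_B A_i$ be the amalgamated free product C*-algebra, that is, the Hausdorff completion of $\ast_B A_i$ with respect to the seminorm $$\|x\| = \sup\{\|\pi(x)\| : \pi \text{ is a unital } *\text{-representation of } \ast_B A_i \text{ on a Hilbert space}\},$$ with its canonical unital $*$-homomorphisms $\phi_i : A_i \to \check{\ast}_B A_i$. Let $H$ be a complex Hilbert space and let $\Phi_i : A_i \to \mathcal{B}(H)$, $i \in I$, be unital completely positive maps which restrict to a common linear map on $B$, i.e. $\Phi_i\circ\varepsilon_i = \Phi_j\circ\varepsilon_j$ for all $i,j\in I$. Then there is a unital completely positive map $\Phi : \check{\ast}_B A_i \to \mathcal{B}(H)$ such that $\Phi\circ\phi_i = \Phi_i$ for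 all $i\in I$. -/

import Mathlib

open scoped CStarAlgebra
open UniformSpace

universe uI uB uA

/-!
The amalgamated free product of a family of unital C⋆-algebras `A i` over a unital C⋆-algebra `B`,
along unital `*`-homomorphisms `ε i : B → A i`: first the `*`-algebraic amalgamated free product,
then its Hausdorff completion in the largest seminorm coming from Hilbert space representations.
-/

namespace AmalgFree

noncomputable section

variable {I : Type uI} {B : Type uB} {A : I → Type uA} [CStarAlgebra B] [∀ i, CStarAlgebra (A i)]

/-! ### The `*`-algebraic amalgamated free product -/

/-- The relations of the algebraic amalgamated free product, on the free unital complex algebra with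
one generator for each element of each `A i`: every `A i → (quotient)` is a homomorphism of unital
complex algebras, and the copies of `B` inside the `A i` are identified. -/
inductive Rel (ε : ∀ i, B →⋆ₐ[ℂ] A i) :
    FreeAlgebra ℂ (Σ i, A i) → FreeAlgebra ℂ (Σ i, A i) → Prop
  | add (i : I) (a b : A i) : Rel ε (FreeAlgebra.ι ℂ ⟨i, a + b⟩)
      (FreeAlgebra.ι ℂ ⟨i, a⟩ + FreeAlgebra.ι ℂ ⟨i, b⟩)
  | mul (i : I) (a b : A i) : Rel ε (FreeAlgebra.ι ℂ ⟨i, a * b⟩)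
      (FreeAlgebra.ι ℂ ⟨i, a⟩ * FreeAlgebra.ι ℂ ⟨i, b⟩)
  | scalar (i : I) (c : ℂ) : Rel ε (FreeAlgebra.ι ℂ ⟨i, algebraMap ℂ (A i) c⟩)
      (algebraMap ℂ (FreeAlgebra ℂ (Σ i, A i)) c)
  | amalg (i j : I) (b : B) : Rel ε (FreeAlgebra.ι ℂ ⟨i, ε i b⟩) (FreeAlgebra.ι ℂ ⟨j, ε j b⟩)

/-- The `*`-algebraic amalgamated free product of the `A i` over `B`. -/
def AlgProd (ε : ∀ i, B →⋆ₐ[ℂ] A i) : Type (max uI uA) := RingQuot (Rel ε)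

namespace AlgProd

variable (ε : ∀ i, B →⋆ₐ[ℂ] A i)

instance instRing : Ring (AlgProd ε) := inferInstanceAs (Ring (RingQuot (Rel ε)))

instance instAlgebra : Algebra ℂ (AlgProd ε) := inferInstanceAs (Algebra ℂ (RingQuot (Rel ε)))

/-- The quotient map. -/
def mk : FreeAlgebra ℂ (Σ i, A i) →ₐ[ℂ] AlgProd ε := RingQuot.mkAlgHom ℂ (Rel ε)

theorem mk_rel {x y : FreeAlgebra ℂ (Σ i, A i)} (h : Rel ε x y) : mk ε x = mk ε y :=
  RingQuot.mkAlgHom_rel ℂ h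

theorem mk_surjective : Function.Surjective (mk ε) := RingQuot.mkAlgHom_surjective ℂ (Rel ε)

/-- The canonical homomorphism `A i → AlgProd ε`, as a map of algebras. -/
def inclAlg (i : I) : A i →ₐ[ℂ] AlgProd ε where
  toFun a := mk ε (FreeAlgebra.ι ℂ ⟨i, a⟩)
  map_add' a b := by rw [mk_rel ε (Rel.add i a b), map_add]
  map_mul' a b := by rw [mk_rel ε (Rel.mul i a b), map_mul]
  map_one' := by
    have h := mk_rel ε (Rel.scalar i 1)
    rwa [map_one, map_one, map_one] at h
  map_zero' := by
    have h := mk_rel ε (Rel.scalar i 0)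
    rwa [map_zero, map_zero, map_zero] at h
  commutes' c := by rw [mk_rel ε (Rel.scalar i c), AlgHom.commutes]

theorem inclAlg_amalg (i j : I) (b : B) : inclAlg ε i (ε i b) = inclAlg ε j (ε j b) :=
  mk_rel ε (Rel.amalg i j b)

variable {ε} in
/-- Induction on elements: the images of the `A i` generate. -/
theorem induction {p : AlgProd ε → Prop} (scalar : ∀ c : ℂ, p (algebraMap ℂ (AlgProd ε) c))
    (incl : ∀ i a, p (inclAlg ε i a)) (add : ∀ x y, p x → p y → p (x + y))
    (mul : ∀ x y, p x → p y → p (x * y)) (x : AlgProd ε) : p x := by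
  obtain ⟨x, rfl⟩ := mk_surjective ε x
  induction x using FreeAlgebra.induction with
  | grade0 c => rw [AlgHom.commutes]; exact scalar c
  | grade1 s => exact incl s.1 s.2
  | mul x y hx hy => rw [map_mul]; exact mul _ _ hx hy
  | add x y hx hy => rw [map_add]; exact add _ _ hx hy

/-- A ring homomorphism on the free algebra, not necessarily `ℂ`-linear: the scalars are sent to the
centre by a given `g`, the generators anywhere by a given `f`. -/
def freeLift {X T : Type*} [Ring T] (g : ℂ →+* T) (hg : ∀ c x, g c * x = x * g c) (f : X → T) :
    FreeAlgebra ℂ X →+* T :=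
  letI : Algebra ℂ T := g.toAlgebra' hg
  (FreeAlgebra.lift ℂ f).toRingHom

theorem freeLift_ι {X T : Type*} [Ring T] (g : ℂ →+* T) (hg : ∀ c x, g c * x = x * g c)
    (f : X → T) (x : X) : freeLift g hg f (FreeAlgebra.ι ℂ x) = f x := by
  let _ : Algebra ℂ T := g.toAlgebra' hg
  exact FreeAlgebra.lift_ι_apply f x

theorem freeLift_algebraMap {X T : Type*} [Ring T] (g : ℂ →+* T) (hg : ∀ c x, g c * x = x * g c)
    (f : X → T) (c : ℂ) : freeLift g hg f (algebraMap ℂ _ c) = g c := by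
  let _ : Algebra ℂ T := g.toAlgebra' hg
  exact (FreeAlgebra.lift ℂ f).commutes c

/-- The scalar `c` acts on the opposite algebra as its complex conjugate. -/
def conjScalar : ℂ →+* (AlgProd ε)ᵐᵒᵖ :=
  (algebraMap ℂ (AlgProd ε)ᵐᵒᵖ).comp (starRingEnd ℂ)

theorem conjScalar_comm (c : ℂ) (x : (AlgProd ε)ᵐᵒᵖ) :
    conjScalar ε c * x = x * conjScalar ε c :=
  Algebra.commutes (starRingEnd ℂ c) x

/-- The involution before passing to the quotient. -/
def preStar : FreeAlgebra ℂ (Σ i, A i) →+* (AlgProd ε)ᵐᵒᵖ :=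
  freeLift (conjScalar ε) (conjScalar_comm ε) fun s => MulOpposite.op (inclAlg ε s.1 (star s.2))

theorem preStar_rel ⦃x y : FreeAlgebra ℂ (Σ i, A i)⦄ (h : Rel ε x y) :
    preStar ε x = preStar ε y := by
  induction h with
  | add i a b => simp [preStar, freeLift_ι]
  | mul i a b => simp [preStar, freeLift_ι]
  | scalar i c =>
    simp only [preStar, freeLift_ι, freeLift_algebraMap, conjScalar, ← algebraMap_star_comm]
    rw [AlgHom.commutes]
    rfl
  | amalg i j b =>
    simp only [preStar, freeLift_ι, ← map_star, inclAlg_amalg ε i j]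

/-- The involution as a ring homomorphism to the opposite ring: the conjugate-linear
antihomomorphism that restricts to the involution of each `A i`. -/
def starHom : AlgProd ε →+* (AlgProd ε)ᵐᵒᵖ := RingQuot.lift ⟨preStar ε, preStar_rel ε⟩

theorem starHom_mk (x : FreeAlgebra ℂ (Σ i, A i)) : starHom ε (mk ε x) = preStar ε x := by
  have h : mk ε x = RingQuot.mkRingHom (Rel ε) x := by
    rw [← RingQuot.mkAlgHom_coe ℂ]; rfl
  rw [h]
  exact RingQuot.lift_mkRingHom_apply (preStar ε) (preStar_rel ε) x

theorem starHom_incl (i : I) (a : A i) :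
    starHom ε (inclAlg ε i a) = MulOpposite.op (inclAlg ε i (star a)) :=
  (starHom_mk ε _).trans (freeLift_ι _ _ _ _)

theorem starHom_algebraMap (c : ℂ) :
    starHom ε (algebraMap ℂ _ c) = MulOpposite.op (algebraMap ℂ (AlgProd ε) (star c)) := by
  rw [← (mk ε).commutes, starHom_mk]
  exact freeLift_algebraMap _ _ _ _

instance instStarRing : StarRing (AlgProd ε) where
  star x := (starHom ε x).unop
  star_involutive x := by
    induction x using AlgProd.induction with
    | scalar c => simp [starHom_algebraMap]
    | incl i a => simp [starHom_incl]
    | add x y hx hy => simp_all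
    | mul x y hx hy => simp_all
  star_mul x y := by simp
  star_add x y := by simp

theorem star_incl (i : I) (a : A i) : star (inclAlg ε i a) = inclAlg ε i (star a) :=
  congrArg MulOpposite.unop (starHom_incl ε i a)

theorem star_algebraMap (c : ℂ) :
    star (algebraMap ℂ (AlgProd ε) c) = algebraMap ℂ (AlgProd ε) (star c) :=
  congrArg MulOpposite.unop (starHom_algebraMap ε c)

instance instStarModule : StarModule ℂ (AlgProd ε) where
  star_smul c x := by
    rw [Algebra.smul_def, star_mul, star_algebraMap, Algebra.smul_def, Algebra.commutes]

/-- The canonical `*`-homomorphism `A i → AlgProd ε`. -/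
def incl (i : I) : A i →⋆ₐ[ℂ] AlgProd ε where
  toAlgHom := inclAlg ε i
  map_star' a := (star_incl ε i a).symm

end AlgProd

/-! ### The maximal C⋆-seminorm -/

/-- A unital `*`-representation of the algebraic amalgamated free product on a Hilbert space.
The Hilbert spaces are taken in the universe of the algebra: every cyclic representation is
unitarily equivalent to one of these, so larger Hilbert spaces give the same supremum below. -/
structure Rep (ε : ∀ i, B →⋆ₐ[ℂ] A i) where
  /-- The Hilbert space. -/
  K : Type (max uI uA)
  [normed : NormedAddCommGroup K]
  [inner : InnerProductSpace ℂ K]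
  [complete : CompleteSpace K]
  /-- The representation. -/
  π : AlgProd ε →⋆ₐ[ℂ] (K →L[ℂ] K)

attribute [instance] Rep.normed Rep.inner Rep.complete

namespace AlgProd

variable {ε : ∀ i, B →⋆ₐ[ℂ] A i}

/-- `‖x‖ = sup {‖π x‖ : π a *-representation}`. -/
def maxNorm (x : AlgProd ε) : ℝ := ⨆ ρ : Rep ε, ‖ρ.π x‖

/-- The supremum is finite. -/
theorem bddAbove (x : AlgProd ε) : BddAbove (Set.range fun ρ : Rep ε => ‖ρ.π x‖) := by
  suffices h : ∃ C : ℝ, ∀ ρ : Rep ε, ‖ρ.π x‖ ≤ C by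
    obtain ⟨C, hC⟩ := h
    exact ⟨C, by rintro _ ⟨ρ, rfl⟩; exact hC ρ⟩
  induction x using AlgProd.induction with
  | scalar c =>
    refine ⟨‖c‖, fun ρ => ?_⟩
    rw [AlgHomClass.commutes, Algebra.algebraMap_eq_smul_one, norm_smul]
    exact mul_le_of_le_one_right (norm_nonneg c) ContinuousLinearMap.norm_id_le
  | incl i a =>
    exact ⟨‖a‖, fun ρ => NonUnitalStarAlgHom.norm_apply_le (ρ.π.comp (incl ε i)) a⟩
  | add x y hx hy =>
    obtain ⟨C, hC⟩ := hx
    obtain ⟨D, hD⟩ := hy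
    refine ⟨C + D, fun ρ => ?_⟩
    rw [map_add]
    exact (norm_add_le _ _).trans (add_le_add (hC ρ) (hD ρ))
  | mul x y hx hy =>
    obtain ⟨C, hC⟩ := hx
    obtain ⟨D, hD⟩ := hy
    refine ⟨C * D, fun ρ => ?_⟩
    rw [map_mul]
    exact (norm_mul_le _ _).trans
      (mul_le_mul (hC ρ) (hD ρ) (norm_nonneg _) ((norm_nonneg _).trans (hC ρ)))

theorem le_maxNorm (ρ : Rep ε) (x : AlgProd ε) : ‖ρ.π x‖ ≤ maxNorm x := le_ciSup (bddAbove x) ρ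

theorem maxNorm_nonneg (x : AlgProd ε) : 0 ≤ maxNorm x := Real.iSup_nonneg fun _ => norm_nonneg _

theorem maxNorm_le {x : AlgProd ε} {C : ℝ} (hC : 0 ≤ C) (h : ∀ ρ : Rep ε, ‖ρ.π x‖ ≤ C) :
    maxNorm x ≤ C :=
  Real.iSup_le h hC

variable (ε) in
/-- The supremum as a submultiplicative seminorm. -/
def maxSeminorm : RingSeminorm (AlgProd ε) where
  toFun := maxNorm
  map_zero' := by simp [maxNorm]
  add_le' x y := maxNorm_le (add_nonneg (maxNorm_nonneg x) (maxNorm_nonneg y)) fun ρ => by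
    rw [map_add]
    exact (norm_add_le _ _).trans (add_le_add (le_maxNorm ρ x) (le_maxNorm ρ y))
  neg' x := by simp [maxNorm]
  mul_le' x y := maxNorm_le (mul_nonneg (maxNorm_nonneg x) (maxNorm_nonneg y)) fun ρ => by
    rw [map_mul]
    exact (norm_mul_le _ _).trans
      (mul_le_mul (le_maxNorm ρ x) (le_maxNorm ρ y) (norm_nonneg _) (maxNorm_nonneg x))

instance instSeminormedRing : SeminormedRing (AlgProd ε) := (maxSeminorm ε).toSeminormedRing

theorem norm_def (x : AlgProd ε) : ‖x‖ = ⨆ ρ : Rep ε, ‖ρ.π x‖ := rfl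

instance instNormedAlgebra : NormedAlgebra ℂ (AlgProd ε) where
  norm_smul_le c x := maxNorm_le (mul_nonneg (norm_nonneg c) (maxNorm_nonneg x)) fun ρ => by
    rw [map_smul, norm_smul]
    exact mul_le_mul_of_nonneg_left (le_maxNorm ρ x) (norm_nonneg c)

instance instNormedStarGroup : NormedStarGroup (AlgProd ε) where
  norm_star_le x := maxNorm_le (maxNorm_nonneg x) fun ρ => by
    rw [map_star, norm_star]
    exact le_maxNorm ρ x

/-- The C⋆-inequality for the seminorm. -/
theorem norm_mul_self_le (x : AlgProd ε) : ‖x‖ * ‖x‖ ≤ ‖star x * x‖ := by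
  have h : ‖x‖ ≤ Real.sqrt ‖star x * x‖ := maxNorm_le (Real.sqrt_nonneg _) fun ρ => by
    refine Real.le_sqrt_of_sq_le ?_
    rw [sq, ← CStarRing.norm_star_mul_self, ← map_star, ← map_mul]
    exact le_maxNorm ρ _
  calc ‖x‖ * ‖x‖ ≤ Real.sqrt ‖star x * x‖ * Real.sqrt ‖star x * x‖ :=
        mul_self_le_mul_self (norm_nonneg x) h
    _ = ‖star x * x‖ := Real.mul_self_sqrt (norm_nonneg _)

end AlgProd

/-! ### The amalgamated free product C⋆-algebra -/

/-- The amalgamated free product of the C⋆-algebras `A i` over `B`: the Hausdorff completion of the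
`*`-algebraic amalgamated free product in the seminorm `‖x‖ = sup {‖π x‖}`. -/
def FreeProd (ε : ∀ i, B →⋆ₐ[ℂ] A i) : Type (max uI uA) := Completion (AlgProd ε)

namespace FreeProd

variable (ε : ∀ i, B →⋆ₐ[ℂ] A i)

instance instNormedRing : NormedRing (FreeProd ε) :=
  inferInstanceAs (NormedRing (Completion (AlgProd ε)))

instance instCompleteSpace : CompleteSpace (FreeProd ε) :=
  inferInstanceAs (CompleteSpace (Completion (AlgProd ε)))

instance instNormedAlgebra : NormedAlgebra ℂ (FreeProd ε) where
  toAlgebra := inferInstanceAs (Algebra ℂ (Completion (AlgProd ε)))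
  norm_smul_le c x := norm_smul_le (β := Completion (AlgProd ε)) c x

/-- The canonical map to the completion. -/
def ofAlg : AlgProd ε →ₐ[ℂ] FreeProd ε where
  toRingHom := (Completion.coeRingHom : AlgProd ε →+* Completion (AlgProd ε))
  commutes' _ := rfl

theorem norm_ofAlg (x : AlgProd ε) : ‖ofAlg ε x‖ = ‖x‖ := Completion.norm_coe x

theorem denseRange_ofAlg : DenseRange (ofAlg ε) := Completion.denseRange_coe

theorem uniformContinuous_star : UniformContinuous (star : AlgProd ε → AlgProd ε) :=
  (AddMonoidHomClass.isometry_of_norm (starAddEquiv : AlgProd ε ≃+ AlgProd ε)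
    norm_star).uniformContinuous

instance instStar : Star (FreeProd ε) where
  star := Completion.map (star : AlgProd ε → AlgProd ε)

theorem star_ofAlg (x : AlgProd ε) : star (ofAlg ε x) = ofAlg ε (star x) :=
  Completion.map_coe (uniformContinuous_star ε) x

theorem continuous_star' : Continuous (star : FreeProd ε → FreeProd ε) := Completion.continuous_map

variable {ε} in
theorem induction {p : FreeProd ε → Prop} (hp : IsClosed {x | p x}) (h : ∀ x, p (ofAlg ε x))
    (x : FreeProd ε) : p x :=
  Completion.induction_on x hp h

variable {ε} in
theorem induction₂ {p : FreeProd ε → FreeProd ε → Prop}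
    (hp : IsClosed {x : FreeProd ε × FreeProd ε | p x.1 x.2})
    (h : ∀ x y, p (ofAlg ε x) (ofAlg ε y)) (x y : FreeProd ε) : p x y :=
  Completion.induction_on₂ x y hp h

instance instStarRing : StarRing (FreeProd ε) where
  star_involutive x := by
    have hc := continuous_star' ε
    induction x using FreeProd.induction with
    | hp => exact isClosed_eq (hc.comp hc) continuous_id
    | h x => rw [star_ofAlg, star_ofAlg, star_star]
  star_mul x y := by
    have hc := continuous_star' ε
    induction x, y using FreeProd.induction₂ with
    | hp => exact isClosed_eq (by fun_prop) (by fun_prop)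
    | h x y => rw [← map_mul, star_ofAlg, star_mul, map_mul, star_ofAlg, star_ofAlg]
  star_add x y := by
    have hc := continuous_star' ε
    induction x, y using FreeProd.induction₂ with
    | hp => exact isClosed_eq (by fun_prop) (by fun_prop)
    | h x y => rw [← map_add, star_ofAlg, star_add, map_add, star_ofAlg, star_ofAlg]

theorem star_smul' (c : ℂ) (x : FreeProd ε) : star (c • x) = star c • star x := by
  have hc := continuous_star' ε
  induction x using FreeProd.induction with
  | hp =>
    exact isClosed_eq (hc.comp (continuous_const_smul c)) (hc.const_smul (star c))
  | h x =>
    have hs : ∀ (d : ℂ) (y : AlgProd ε), ofAlg ε (d • y) = d • ofAlg ε y :=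
      (ofAlg ε).toLinearMap.map_smul
    rw [← hs, star_ofAlg, star_ofAlg, star_smul, hs]

instance instCStarAlgebra : CStarAlgebra (FreeProd ε) where
  norm_mul_self_le x := by
    have hc := continuous_star' ε
    induction x using FreeProd.induction with
    | hp => exact isClosed_le (by fun_prop) (by fun_prop)
    | h x =>
      rw [star_ofAlg, ← map_mul, norm_ofAlg, norm_ofAlg]
      exact AlgProd.norm_mul_self_le x
  star_smul := star_smul' ε

/-- The standard order of a C⋆-algebra: positive means selfadjoint with nonnegative spectrum. -/
instance instPartialOrder : PartialOrder (FreeProd ε) := CStarAlgebra.spectralOrder _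

instance instStarOrderedRing : StarOrderedRing (FreeProd ε) := CStarAlgebra.spectralOrderedRing _

/-- The canonical `*`-homomorphism of `A i` into the amalgamated free product. -/
def incl (i : I) : A i →⋆ₐ[ℂ] FreeProd ε where
  toAlgHom := (ofAlg ε).comp (AlgProd.incl ε i).toAlgHom
  map_star' a := by
    change ofAlg ε (AlgProd.incl ε i (star a)) = star (ofAlg ε (AlgProd.incl ε i a))
    rw [map_star, star_ofAlg]

end FreeProd

end

end AmalgFree

open scoped CStarAlgebra ComplexOrder InnerProductSpace
open UniformSpace

universe uE uX uY vI vH vA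

/-! Suppose the `Φ i` have Stinespring dilations `π i` on one Hilbert space `K`, with one isometry
`V : H → K`, and the `π i` agree on `B`. Then the `π i` assemble to a representation of the free
product, and compressing it by `V` gives the required map. So everything rests on making dilations
agree on `B`.

Inside any dilation of `Φ i`, the `B`-submodule generated by `H` has Gram matrix `⟪h, Φ i (ε i (star
b * b')) h'⟫`, which is independent of `i`. Only the orthogonal complements of these submodules can
differ as `B`-modules. To absorb the difference, the Stinespring space of each `Φ i` is enlarged to
a space `X i` by adding `J` copies of the cyclic representation of every positive functional on `A
i`, for a huge index set `J` (`dilationKernel`, `exists_rep_of_kernel`).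

Over `B`, the complement in `X i` splits into cyclic pieces. The vector functional of each piece
extends to `A k` by the M. Riesz extension theorem, so the piece sits in a cyclic summand of `X k`;
injectivity of `ε k` is needed here. As `J` is large enough to give different pieces different
summands, `X i` embeds in `X k` over `B`, fixing `H` (`exists_linearIsometry_of_cyclic_copies`). The
same holds with `i` and `k` exchanged, and a Schröder–Bernstein argument relative to `H`
(`exists_linearIsometryEquiv_intertwining`) gives a unitary `X i ≃ X k` over `B` fixing `H`.
Transporting all representations to one `X k` yields the common dilation. -/

/-! ### Certificates of positivity in C⋆-algebras -/

theorem exists_eq_star_mul_self_of_nonneg {A : Type*} [CStarAlgebra A] [PartialOrder A]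
    [StarOrderedRing A] {a : A} (ha : 0 ≤ a) : ∃ s : A, a = star s * s :=
  CStarAlgebra.nonneg_iff_eq_star_mul_self.mp ha

/-- A certificate for nonnegativity of a selfadjoint element: `n` is the negative part. -/
theorem IsSelfAdjoint.exists_conj_eq_neg_star_mul_self {A : Type*} [CStarAlgebra A] [PartialOrder A]
    [StarOrderedRing A] {a : A} (ha : IsSelfAdjoint a) :
    ∃ n r : A, star n = n ∧ n * a * n = -(star r * r) ∧ (r = 0 → 0 ≤ a) := by
  -- With `a⁻ = star s * s`, the witnesses are `n = a⁻` and `r = s * a⁻`: both `-(n * a * n)` and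
  -- `star r * r` are the cube of `a⁻`.
  have hn : 0 ≤ a⁻ := CFC.negPart_nonneg a
  obtain ⟨s, hs⟩ := CStarAlgebra.nonneg_iff_eq_star_mul_self.mp hn
  have hsa : star a⁻ = a⁻ := hn.isSelfAdjoint
  have h1 : a⁻ * a = -(a⁻ * a⁻) := by
    conv_lhs => enter [2]; rw [← CFC.posPart_sub_negPart a ha]
    rw [mul_sub, CFC.negPart_mul_posPart, zero_sub]
  have h2 : star (s * a⁻) * (s * a⁻) = a⁻ * a⁻ * a⁻ := by
    rw [star_mul, hsa, mul_assoc, ← mul_assoc (star s), ← hs, mul_assoc]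
  refine ⟨a⁻, s * a⁻, hsa, by rw [h2, h1, neg_mul], fun h => ?_⟩
  -- If the cube of `a⁻` vanishes, so does its fourth power, and two uses of the C⋆-identity give
  -- `a⁻ = 0`.
  rw [h, mul_zero] at h2
  have h3 : star (a⁻ * a⁻) * (a⁻ * a⁻) = 0 := by
    rw [star_mul, hsa, ← mul_assoc, ← h2, zero_mul]
  have h4 : star a⁻ * a⁻ = 0 := by rw [hsa]; exact CStarRing.star_mul_self_eq_zero_iff _ |>.mp h3
  rw [← CFC.negPart_eq_zero_iff a ha]
  exact CStarRing.star_mul_self_eq_zero_iff _ |>.mp h4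

/-- The certificate is algebraic, so `f` transports it: `f (n * b * n)` is nonnegative and equals
`-(star (f r) * f r)`, which forces `f r = 0`, hence `r = 0`. -/
theorem StarAlgHom.nonneg_of_map_nonneg {A B : Type*} [CStarAlgebra A] [CStarAlgebra B]
    [PartialOrder A] [StarOrderedRing A] [PartialOrder B] [StarOrderedRing B]
    (f : B →⋆ₐ[ℂ] A) (hf : Function.Injective f) {b : B} (hb : 0 ≤ f b) : 0 ≤ b := by
  have hsa : IsSelfAdjoint b := hf (by rw [map_star]; exact hb.isSelfAdjoint)
  obtain ⟨n, r, hn, hr, h⟩ := hsa.exists_conj_eq_neg_star_mul_self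
  refine h (hf ?_)
  have h1 : 0 ≤ f (n * b * n) := by
    rw [map_mul, map_mul]
    nth_rw 1 [← hn]
    rw [map_star]
    exact star_left_conjugate_nonneg hb (f n)
  rw [hr, map_neg, map_mul, map_star, neg_nonneg] at h1
  rw [map_zero]
  exact (CStarRing.star_mul_self_eq_zero_iff _).mp (le_antisymm h1 (star_mul_self_nonneg _))

/-! ### Matrices of operators and their sesquilinear forms -/

namespace CStarMatrix

variable {H : Type*} [NormedAddCommGroup H] [InnerProductSpace ℂ H]
  {n : Type*} [Fintype n]

/-- The action of a matrix of operators on a vector of vectors. -/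
def actVec (M : CStarMatrix n n (H →L[ℂ] H)) (h : n → H) (s : n) : H := ∑ t, M s t (h t)

theorem actVec_mul (M N : CStarMatrix n n (H →L[ℂ] H)) (h : n → H) :
    (M * N).actVec h = M.actVec (N.actVec h) := by
  ext s
  simp only [actVec, mul_apply, sum_apply, map_sum]
  rw [Finset.sum_comm]
  rfl

variable [CompleteSpace H]

theorem sum_inner_actVec_star (M : CStarMatrix n n (H →L[ℂ] H)) (h g : n → H) :
    ∑ s, ⟪h s, (star M).actVec g s⟫_ℂ = ∑ s, ⟪M.actVec h s, g s⟫_ℂ := by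
  simp only [actVec, star_apply, inner_sum, sum_inner, ContinuousLinearMap.star_eq_adjoint,
    ContinuousLinearMap.adjoint_inner_right]
  exact Finset.sum_comm

theorem sum_inner_actVec_star_mul_self (R : CStarMatrix n n (H →L[ℂ] H)) (h : n → H) :
    (∑ s, ⟪h s, (star R * R).actVec h s⟫_ℂ).re = ∑ s, ‖R.actVec h s‖ ^ 2 := by
  rw [actVec_mul, sum_inner_actVec_star, Complex.re_sum]
  exact Finset.sum_congr rfl fun s _ => inner_self_eq_norm_sq (𝕜 := ℂ) _

/-- A matrix of operators is nonnegative as soon as its sesquilinear form is. -/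
theorem nonneg_of_sum_inner_nonneg [DecidableEq n] (M : CStarMatrix n n (H →L[ℂ] H))
    (hsa : IsSelfAdjoint M) (hM : ∀ h : n → H, 0 ≤ (∑ s, ⟪h s, M.actVec h s⟫_ℂ).re) :
    0 ≤ M := by
  obtain ⟨N, R, hN, hR, hpos⟩ := hsa.exists_conj_eq_neg_star_mul_self
  refine hpos ?_
  -- Evaluated at `N h`, the form of `M` is that of `N * M * N = -(star R * R)` at `h`, namely `-∑
  -- ‖R h‖²`; being nonnegative, it vanishes.
  have key : ∀ (h : n → H) k, R.actVec h k = 0 := by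
    intro h
    have h1 := hM (N.actVec h)
    have h2 : (-(star R * R)).actVec h = -(star R * R).actVec h := by
      ext s; simp [actVec]
    rw [← sum_inner_actVec_star, hN, ← actVec_mul, ← actVec_mul, hR, h2] at h1
    simp only [Pi.neg_apply, inner_neg_right, Finset.sum_neg_distrib, Complex.neg_re,
      sum_inner_actVec_star_mul_self] at h1
    have h4 : ∑ k, ‖R.actVec h k‖ ^ 2 = 0 :=
      le_antisymm (neg_nonneg.mp h1) (Finset.sum_nonneg fun _ _ => by positivity)
    intro k
    have := (Finset.sum_eq_zero_iff_of_nonneg fun _ _ => by positivity).mp h4 k (Finset.mem_univ k)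
    simpa using this
  ext k t x
  have := key (Pi.single t x) k
  rw [actVec, Finset.sum_eq_single t] at this
  · simpa using this
  · intro u _ hu; simp [hu]
  · simp

end CStarMatrix

/-- The matrix with entries `star (a s) * a t` is `star R * R`, where `R` has the row `a` at one
chosen index and zeros elsewhere. Its image under `Φ` is again of the form `star S * S`. -/
theorem CompletelyPositiveMap.sum_inner_nonneg {A H : Type*} [CStarAlgebra A] [PartialOrder A]
    [StarOrderedRing A] [NormedAddCommGroup H] [InnerProductSpace ℂ H] [CompleteSpace H]
    (Φ : A →CP (H →L[ℂ] H)) {n : Type*} [Fintype n] [DecidableEq n] (a : n → A) (h : n → H) :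
    0 ≤ (∑ s, ∑ t, ⟪h s, Φ (star (a s) * a t) (h t)⟫_ℂ).re := by
  rcases isEmpty_or_nonempty n with hn | ⟨⟨s₀⟩⟩
  · simp
  let R : CStarMatrix n n A := CStarMatrix.ofMatrix fun s t => if s = s₀ then a t else 0
  have hR₁ : ∀ t, R s₀ t = a t := fun t => if_pos rfl
  have hR₀ : ∀ s t, s ≠ s₀ → R s t = 0 := fun s t h => if_neg h
  have hR : ∀ s t, (star R * R) s t = star (a s) * a t := fun s t => by
    rw [CStarMatrix.mul_apply, Finset.sum_eq_single s₀]
    · rw [CStarMatrix.star_apply, hR₁, hR₁]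
    · intro u _ hu; rw [hR₀ _ t hu, mul_zero]
    · simp
  have h0 : 0 ≤ (star R * R).map Φ := Φ.map_cstarMatrix_nonneg _ (star_mul_self_nonneg R)
  obtain ⟨S, hS⟩ := exists_eq_star_mul_self_of_nonneg h0
  have h1 := CStarMatrix.sum_inner_actVec_star_mul_self S h
  rw [← hS] at h1
  simp only [CStarMatrix.actVec, CStarMatrix.map_apply, hR, inner_sum] at h1
  rw [h1]
  exact Finset.sum_nonneg fun _ _ => by positivity

/-! ### Positive functionals and their extension -/

/-- The positive linear functionals on a `*`-algebra. -/
abbrev PosFunctional (A : Type*) [Ring A] [StarRing A] [Algebra ℂ A] : Type _ :=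
  {φ : A →ₗ[ℂ] ℂ // ∀ a, 0 ≤ φ (star a * a)}

theorem PosFunctional.apply_star {A : Type*} [CStarAlgebra A] (φ : PosFunctional A) (a : A) :
    φ.1 (star a) = star (φ.1 a) := by
  let _ : PartialOrder A := CStarAlgebra.spectralOrder A
  have _ : StarOrderedRing A := CStarAlgebra.spectralOrderedRing A
  let f : A →ₚ[ℂ] ℂ := PositiveLinearMap.mk₀ φ.1 fun x hx => by
    obtain ⟨s, rfl⟩ := CStarAlgebra.nonneg_iff_eq_star_mul_self.mp hx
    exact φ.2 s
  exact map_star f a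

/-- Positive functionals extend along embeddings of C⋆-algebras. -/
theorem PosFunctional.exists_extension {A B : Type*} [CStarAlgebra A] [CStarAlgebra B]
    (f : B →⋆ₐ[ℂ] A) (hf : Function.Injective f) (φ : PosFunctional B) :
    ∃ ψ : PosFunctional A, ∀ b, ψ.1 (f b) = φ.1 b := by
  let _ : PartialOrder A := CStarAlgebra.spectralOrder A
  have _ : StarOrderedRing A := CStarAlgebra.spectralOrderedRing A
  let _ : PartialOrder B := CStarAlgebra.spectralOrder B
  have _ : StarOrderedRing B := CStarAlgebra.spectralOrderedRing B
  -- The cone of elements with nonnegative real part makes the Riesz theorem applicable to all of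
  -- `A` as a real space, instead of its selfadjoint part. The functional to extend is `Re φ` on the
  -- range of `f`.
  let s : PointedCone ℝ A :=
    { carrier := {a | 0 ≤ a + star a}
      add_mem' := fun {a b} ha hb => by
        simp only [Set.mem_ofPred_eq, star_add] at ha hb ⊢
        have := add_nonneg ha hb
        convert! this using 1
        abel
      zero_mem' := by simp
      smul_mem' := fun c a ha => by
        have h : (c : ℝ) • (a + star a) = c • a + star (c • a) := by
          rw [smul_add]
          congr 1
          change (c : ℝ) • star a = star ((c : ℝ) • a)
          rw [star_smul]
          simp
        simp only [Set.mem_ofPred_eq, ← h]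
        exact smul_nonneg c.2 ha }
  have hs : ∀ a, a ∈ s ↔ 0 ≤ a + star a := fun _ => Iff.rfl
  let e : B ≃ₗ[ℂ] LinearMap.range f.toAlgHom.toLinearMap :=
    LinearEquiv.ofInjective f.toAlgHom.toLinearMap hf
  have he : ∀ x, f (e.symm x) = x := fun x => congrArg Subtype.val (e.apply_symm_apply x)
  let p : A →ₗ.[ℝ] ℝ :=
    { domain := (LinearMap.range f.toAlgHom.toLinearMap).restrictScalars ℝ
      toFun := Complex.reLm ∘ₗ (φ.1 ∘ₗ e.symm.toLinearMap).restrictScalars ℝ }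
  obtain ⟨g, hg, hpos⟩ := riesz_extension s p (by
      intro x hx
      have h1 : 0 ≤ f (e.symm x + star (e.symm x)) := by
        rw [map_add, map_star]
        exact (he x).symm ▸ (hs _).mp hx
      obtain ⟨d, hd⟩ := CStarAlgebra.nonneg_iff_eq_star_mul_self.mp
        (f.nonneg_of_map_nonneg hf h1)
      have h2 := φ.2 d
      rw [← hd, map_add, φ.apply_star] at h2
      have h3 := (Complex.le_def.mp h2).1
      simp at h3
      change 0 ≤ (φ.1 (e.symm x)).re
      linarith) (by
      intro y
      -- Cofinality: the scalar `‖y + star y‖` already suffices, since it dominates `-(y + star y)`.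
      refine ⟨⟨algebraMap ℝ A ‖y + star y‖, algebraMap ℝ B ‖y + star y‖, ?_⟩, ?_⟩
      · change f (algebraMap ℝ B _) = _
        rw [IsScalarTower.algebraMap_apply ℝ ℂ B, IsScalarTower.algebraMap_apply ℝ ℂ A]
        exact AlgHomClass.commutes f _
      · have h1 : IsSelfAdjoint (y + star y) := IsSelfAdjoint.add_star_self y
        have h2 := h1.neg_algebraMap_norm_le_self
        have h3 : 0 ≤ algebraMap ℝ A ‖y + star y‖ := by
          rw [Algebra.algebraMap_eq_smul_one]
          exact smul_nonneg (norm_nonneg _) zero_le_one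
        have h4 : star (algebraMap ℝ A ‖y + star y‖) = algebraMap ℝ A ‖y + star y‖ :=
          h3.isSelfAdjoint
        rw [hs, star_add, h4]
        have h5 := add_nonneg h3 (neg_le_iff_add_nonneg.mp h2)
        convert! h5 using 1
        abel)
  let ψ : A →ₗ[ℂ] ℂ := Module.Dual.extendRCLike (𝕜 := ℂ) g
  have hψ : ∀ a, ψ a = g a - Complex.I * g (Complex.I • a) := fun a =>
    Module.Dual.extendRCLike_apply g a
  refine ⟨⟨ψ, fun a => ?_⟩, fun b => ?_⟩
  · have h1 : 0 ≤ g (star a * a) := hpos _ (by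
      rw [hs, star_mul, star_star]
      exact add_nonneg (star_mul_self_nonneg _) (star_mul_self_nonneg _))
    -- Imaginary multiples of `star a * a` have real part zero, so they lie in the cone with both
    -- signs and `g` kills them. Hence the complexification `ψ` of `g` is real on `star a * a`.
    have h2 : ∀ c : ℂ, c.re = 0 → 0 ≤ g (c • (star a * a)) := fun c hc => hpos _ (by
      have : star c = -c := by apply Complex.ext <;> simp [hc]
      rw [hs, star_smul, this, star_mul, star_star, neg_smul, add_neg_cancel])
    have h3 := h2 Complex.I (by simp)
    have h4 := h2 (-Complex.I) (by simp)
    rw [neg_smul, map_neg] at h4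
    have h5 : g (Complex.I • (star a * a)) = 0 := by linarith
    rw [hψ, h5]
    simpa using h1
  · have h1 : ∀ b, g (f b) = (φ.1 b).re := fun b => by
      have := hg ⟨f b, b, rfl⟩
      refine this.trans ?_
      change (φ.1 (e.symm _)).re = _
      congr 2
      exact hf (he _)
    change ψ (f b) = _
    rw [hψ, ← map_smul, h1, h1, map_smul]
    apply Complex.ext <;> simp

/-! ### Hilbert spaces and representations from kernels -/

section Hilbert

variable {X Y : Type*} [NormedAddCommGroup X] [InnerProductSpace ℂ X]
  [NormedAddCommGroup Y] [InnerProductSpace ℂ Y]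

theorem dense_span_of_forall_inner_eq_zero [CompleteSpace X] {s : Set X}
    (h : ∀ x : X, (∀ v ∈ s, ⟪v, x⟫_ℂ = 0) → x = 0) :
    Dense (Submodule.span ℂ s : Set X) := by
  rw [Submodule.dense_iff_topologicalClosure_eq_top,
    Submodule.topologicalClosure_eq_top_iff, Submodule.eq_bot_iff]
  exact fun x hx => h x fun v hv => (Submodule.mem_orthogonal _ _).mp hx v (Submodule.subset_span hv)

/-- Two families with the same Gram matrix, the first one total, are related by an isometry. -/
theorem exists_linearIsometry_of_gram [CompleteSpace Y] {Λ : Type*} {v : Λ → X} {w : Λ → Y}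
    (hv : Dense (Submodule.span ℂ (Set.range v) : Set X))
    (h : ∀ a b, ⟪v a, v b⟫_ℂ = ⟪w a, w b⟫_ℂ) : ∃ V : X →ₗᵢ[ℂ] Y, ∀ a, V (v a) = w a := by
  let e := Finsupp.linearCombination ℂ v
  let f := Finsupp.linearCombination ℂ w
  have he : DenseRange e := by
    rw [DenseRange, ← LinearMap.coe_range, Finsupp.range_linearCombination]
    exact hv
  have hinner : ∀ x, ⟪e x, e x⟫_ℂ = ⟪f x, f x⟫_ℂ := fun x => by
    simp only [e, f, Finsupp.linearCombination_apply, Finsupp.sum, sum_inner, inner_sum,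
      inner_smul_left, inner_smul_right, h]
  have hn : ∀ x, ‖f x‖ = ‖e x‖ := fun x => by
    rw [@norm_eq_sqrt_re_inner ℂ, @norm_eq_sqrt_re_inner ℂ, hinner]
  have hb : ∃ C : ℝ, ∀ x, ‖f x‖ ≤ C * ‖e x‖ := ⟨1, fun x => by rw [hn, one_mul]⟩
  let g := f.extendOfNorm e
  have hg : ∀ x, g (e x) = f x := LinearMap.extendOfNorm_eq he hb
  refine ⟨⟨g.toLinearMap, fun x => ?_⟩, fun a => ?_⟩
  · refine he.induction_on (p := fun x => ‖g x‖ = ‖x‖) x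
      (isClosed_eq (by fun_prop) (by fun_prop)) fun y => ?_
    rw [hg, hn]
  · have := hg (Finsupp.single a 1)
    simpa [e, f] using this

/-- A map preserving inner products is a linear isometry. -/
theorem exists_linearIsometry_of_inner [CompleteSpace Y] {j : X → Y}
    (h : ∀ x y, ⟪j x, j y⟫_ℂ = ⟪x, y⟫_ℂ) : ∃ V : X →ₗᵢ[ℂ] Y, ∀ x, V x = j x :=
  exists_linearIsometry_of_gram (v := id) (by simp) fun a b => (h a b).symm

end Hilbert

/-- A pre-inner product on a module over a `*`-algebra, invariant under the action and such that
the action is bounded, gives a representation on the completion. -/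
theorem exists_rep_of_preInner {A : Type*} {E : Type uE} [Ring A] [StarRing A] [Algebra ℂ A]
    [AddCommGroup E] [Module ℂ E] (c : PreInnerProductSpace.Core ℂ E)
    (L : A →ₐ[ℂ] Module.End ℂ E)
    (hadj : ∀ a x y, c.inner (L (star a) x) y = c.inner x (L a y))
    (hbd : ∀ a, ∃ C : ℝ, ∀ x, (c.inner (L a x) (L a x)).re ≤ C ^ 2 * (c.inner x x).re) :
    ∃ (K : Type uE) (_ : NormedAddCommGroup K) (_ : InnerProductSpace ℂ K) (_ : CompleteSpace K)
      (π : A →⋆ₐ[ℂ] (K →L[ℂ] K)) (ι : E →ₗ[ℂ] K), DenseRange ι ∧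
      (∀ x y, ⟪ι x, ι y⟫_ℂ = c.inner x y) ∧ ∀ a x, π a (ι x) = ι (L a x) := by
  let _ : SeminormedAddCommGroup E := InnerProductSpace.Core.toSeminormedAddCommGroup (c := c)
  let _ : InnerProductSpace ℂ E := InnerProductSpace.ofCore c
  have hin : ∀ x y : E, ⟪x, y⟫_ℂ = c.inner x y := fun _ _ => rfl
  have hnorm : ∀ a, ∃ C : ℝ, ∀ x, ‖L a x‖ ≤ C * ‖x‖ := fun a => by
    obtain ⟨C, hC⟩ := hbd a
    refine ⟨|C|, fun x => abs_le_of_sq_le_sq' ?_ (by positivity) |>.2⟩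
    rw [mul_pow, sq_abs, ← inner_self_eq_norm_sq (𝕜 := ℂ), ← inner_self_eq_norm_sq (𝕜 := ℂ)]
    exact hC x
  let T : A → (E →L[ℂ] E) := fun a => (L a).mkContinuousOfExistsBound (hnorm a)
  have hT : ∀ a x, T a x = L a x := fun a x => rfl
  let π : A →⋆ₐ[ℂ] (Completion E →L[ℂ] Completion E) :=
    { toFun := fun a => (T a).completion
      map_one' := by
        ext x
        induction x using Completion.induction_on with
        | hp => apply isClosed_eq <;> fun_prop
        | ih x => simp [hT]
      map_mul' := fun a b => by
        ext x
        induction x using Completion.induction_on with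
        | hp => apply isClosed_eq <;> fun_prop
        | ih x => simp [hT]
      map_zero' := by
        ext x
        induction x using Completion.induction_on with
        | hp => apply isClosed_eq <;> fun_prop
        | ih x => simpa [hT] using Completion.coe_zero
      map_add' := fun a b => by
        ext x
        induction x using Completion.induction_on with
        | hp => apply isClosed_eq <;> fun_prop
        | ih x => simp [hT, Completion.coe_add]
      commutes' := fun r => by
        ext x
        induction x using Completion.induction_on with
        | hp => apply isClosed_eq <;> fun_prop
        | ih x => simp [hT, Completion.coe_smul, Algebra.algebraMap_eq_smul_one]
      map_star' := fun a => by
        refine (ContinuousLinearMap.eq_adjoint_iff _ _).mpr fun x y => ?_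
        induction x, y using Completion.induction_on₂ with
        | hp => apply isClosed_eq <;> fun_prop
        | ih x y => simp [hT, hin, hadj] }
  refine ⟨Completion E, inferInstance, inferInstance, inferInstance, π,
    Completion.toComplL.toLinearMap, Completion.denseRange_coe, fun x y => Completion.inner_coe x y,
    fun a x => ?_⟩
  exact ContinuousLinearMap.completion_apply_coe _ _

/-! ### Unitary equivalence and Schröder–Bernstein -/

section Hilbert

variable {X Y : Type*} [NormedAddCommGroup X] [InnerProductSpace ℂ X] [CompleteSpace X]
  [NormedAddCommGroup Y] [InnerProductSpace ℂ Y] [CompleteSpace Y]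

theorem exists_linearIsometryEquiv_of_gram {Λ : Type*} {v : Λ → X} {w : Λ → Y}
    (hv : Dense (Submodule.span ℂ (Set.range v) : Set X))
    (hw : Dense (Submodule.span ℂ (Set.range w) : Set Y))
    (h : ∀ a b, ⟪v a, v b⟫_ℂ = ⟪w a, w b⟫_ℂ) : ∃ V : X ≃ₗᵢ[ℂ] Y, ∀ a, V (v a) = w a := by
  obtain ⟨V, hV⟩ := exists_linearIsometry_of_gram hv h
  obtain ⟨W, hW⟩ := exists_linearIsometry_of_gram hw fun a b => (h a b).symm
  have hVW : V.toContinuousLinearMap ∘L W.toContinuousLinearMap = ContinuousLinearMap.id ℂ Y := by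
    refine ContinuousLinearMap.ext_on hw ?_
    rintro _ ⟨a, rfl⟩
    simp [hV, hW]
  refine ⟨LinearIsometryEquiv.ofSurjective V fun y => ⟨W y, ?_⟩, hV⟩
  exact DFunLike.congr_fun hVW y

/-- The Schröder–Bernstein theorem for families of operators closed under adjoints on Hilbert
spaces, relative to given vectors. -/
theorem exists_linearIsometryEquiv_intertwining {B Λ : Type*} [InvolutiveStar B]
    {σ : B → X →L[ℂ] X} {τ : B → Y →L[ℂ] Y}
    (hσ : ∀ b x x', ⟪σ (star b) x, x'⟫_ℂ = ⟪x, σ b x'⟫_ℂ)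
    (hτ : ∀ b y y', ⟪τ b y, y'⟫_ℂ = ⟪y, τ (star b) y'⟫_ℂ)
    {j : Λ → X} {j' : Λ → Y} (V : X →ₗᵢ[ℂ] Y) (W : Y →ₗᵢ[ℂ] X)
    (hV : ∀ b x, V (σ b x) = τ b (V x)) (hW : ∀ b y, W (τ b y) = σ b (W y))
    (hVj : ∀ l, V (j l) = j' l) (hWj : ∀ l, W (j' l) = j l) :
    ∃ U : X ≃ₗᵢ[ℂ] Y, (∀ b x, U (σ b x) = τ b (U x)) ∧ ∀ l, U (j l) = j' l := by
  -- As in the set-theoretic proof, with orthogonal complements for set complements: at a fixed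
  -- point `S = F S`, the space `X` is the sum of `S` and `W ((V S)ᗮ)`. So `V` on `S` and the
  -- inverse of `W` on the rest define a unitary.
  let F : Submodule ℂ X → Submodule ℂ X := fun S =>
    ((S.map V.toLinearMap)ᗮ.map W.toLinearMap)ᗮ
  have hF : ∀ S x, x ∈ F S ↔ ∀ y, (∀ s ∈ S, ⟪V s, y⟫_ℂ = 0) → ⟪W y, x⟫_ℂ = 0 := fun S x => by
    simp only [F, Submodule.mem_orthogonal, Submodule.mem_map]
    constructor
    · intro h y hy
      refine h _ ⟨y, ?_, rfl⟩
      rintro _ ⟨s, hs, rfl⟩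
      exact hy s hs
    · rintro h _ ⟨y, hy, rfl⟩
      exact h y fun s hs => hy _ ⟨s, hs, rfl⟩
  let P : Submodule ℂ X → Prop := fun S => (∀ b, ∀ x ∈ S, σ b x ∈ S) ∧ ∀ l, j l ∈ S
  have hPF : ∀ S, P S → P (F S) := by
    rintro S ⟨hS, hj⟩
    refine ⟨fun b x hx => (hF _ _).mpr fun y hy => ?_, fun l => (hF _ _).mpr fun y hy => ?_⟩
    · rw [← hσ, ← hW]
      refine (hF _ _).mp hx _ fun s hs => ?_
      rw [← hτ, ← hV]
      exact hy _ (hS b s hs)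
    · rw [← hWj, W.inner_map_map, ← hVj, ← inner_conj_symm, hy _ (hj l), map_zero]
  have hmono : ∀ S S', S ≤ S' → F S ≤ F S' := fun S S' h x hx =>
    (hF _ _).mpr fun y hy => (hF _ _).mp hx y fun s hs => hy s (h hs)
  -- Knaster–Tarski, restricted to invariant subspaces containing the given vectors; `F` preserves
  -- this class, so the least pre-fixed point is a fixed point within it.
  let S := sInf {S | P S ∧ F S ≤ S}
  have hPS : P S := by
    refine ⟨fun b x hx => ?_, fun l => ?_⟩
    · rw [Submodule.mem_sInf] at hx ⊢
      exact fun S hS => hS.1.1 b x (hx S hS)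
    · rw [Submodule.mem_sInf]
      exact fun S hS => hS.1.2 l
  have hFS : F S ≤ S := le_sInf fun T hT => (hmono _ _ (sInf_le hT)).trans hT.2
  have hSF : S ≤ F S := sInf_le ⟨hPF _ hPS, hmono _ _ hFS⟩
  let N := (S.map V.toLinearMap)ᗮ
  have hN : ∀ y, y ∈ N ↔ ∀ s ∈ S, ⟪V s, y⟫_ℂ = 0 := fun y => by
    simp only [N, Submodule.mem_orthogonal, Submodule.mem_map]
    exact ⟨fun h s hs => h _ ⟨s, hs, rfl⟩, by rintro h _ ⟨s, hs, rfl⟩; exact h s hs⟩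
  let v : S ⊕ N → X := Sum.elim (fun s => s) (fun y => W y)
  let w : S ⊕ N → Y := Sum.elim (fun s => V s) (fun y => y)
  have hv : Dense (Submodule.span ℂ (Set.range v) : Set X) := by
    refine dense_span_of_forall_inner_eq_zero fun x hx => ?_
    have h1 : x ∈ S := hFS ((hF _ _).mpr fun y hy => hx _ ⟨Sum.inr ⟨y, (hN y).mpr hy⟩, rfl⟩)
    exact inner_self_eq_zero.mp (hx _ ⟨Sum.inl ⟨x, h1⟩, rfl⟩)
  have hw : Dense (Submodule.span ℂ (Set.range w) : Set Y) := by
    refine dense_span_of_forall_inner_eq_zero fun y hy => ?_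
    have h1 : y ∈ N := (hN y).mpr fun s hs => hy _ ⟨Sum.inl ⟨s, hs⟩, rfl⟩
    exact inner_self_eq_zero.mp (hy _ ⟨Sum.inr ⟨y, h1⟩, rfl⟩)
  have horth : ∀ (s : S) (y : N), ⟪W y, (s : X)⟫_ℂ = 0 := fun s y =>
    (hF _ _).mp (hSF s.2) y ((hN _).mp y.2)
  obtain ⟨U, hU⟩ := exists_linearIsometryEquiv_of_gram (v := v) (w := w) hv hw (by
    rintro (s | y) (s' | y')
    · exact (V.inner_map_map _ _).symm
    · change ⟪(s : X), W y'⟫_ℂ = ⟪V s, (y' : Y)⟫_ℂ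
      rw [(hN _).mp y'.2 s s.2, ← inner_conj_symm, horth, map_zero]
    · change ⟪W y, (s' : X)⟫_ℂ = ⟪(y : Y), V s'⟫_ℂ
      rw [horth, ← inner_conj_symm, (hN _).mp y.2 s' s'.2, map_zero]
    · exact W.inner_map_map _ _)
  have hUS : ∀ s ∈ S, U s = V s := fun s hs => hU (Sum.inl ⟨s, hs⟩)
  have hUN : ∀ y ∈ N, U (W y) = y := fun y hy => hU (Sum.inr ⟨y, hy⟩)
  refine ⟨U, fun b => ?_, fun l => by rw [hUS _ (hPS.2 l), hVj]⟩
  have : (U : X →L[ℂ] Y) ∘L σ b = τ b ∘L (U : X →L[ℂ] Y) := by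
    refine ContinuousLinearMap.ext_on hv ?_
    rintro _ ⟨s | y, rfl⟩
    · change U (σ b s) = τ b (U s)
      rw [hUS _ (hPS.1 b s s.2), hUS _ s.2, hV]
    · change U (σ b (W y)) = τ b (U (W y))
      rw [← hW, hUN _ y.2, hUN]
      -- `N` is invariant under `τ b` because `V S` is invariant under the adjoint `τ (star b)`.
      refine (hN _).mpr fun s hs => ?_
      rw [← star_star b, ← hτ, ← hV]
      exact (hN _).mp y.2 _ (hPS.1 _ s hs)
  exact fun x => DFunLike.congr_fun this x

end Hilbert

/-! ### Kolmogorov decomposition -/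

/-- Kolmogorov decomposition of a positive definite kernel with values in the functionals on a
C⋆-algebra. -/
theorem exists_rep_of_kernel {A : Type uX} {T : Type uY} [CStarAlgebra A]
    (k : T → T → A →ₗ[ℂ] ℂ) (hsymm : ∀ s t a, star (k s t (star a)) = k t s a)
    (hpos : ∀ (F : Finset T) (a : T → A), 0 ≤ (∑ s ∈ F, ∑ t ∈ F, k s t (star (a s) * a t)).re) :
    ∃ (K : Type (max uX uY)) (_ : NormedAddCommGroup K) (_ : InnerProductSpace ℂ K)
      (_ : CompleteSpace K) (π : A →⋆ₐ[ℂ] (K →L[ℂ] K)) (ξ : T → K),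
      Dense (Submodule.span ℂ (Set.range fun p : A × T => π p.1 (ξ p.2)) : Set K) ∧
      ∀ s t a, ⟪ξ s, π a (ξ t)⟫_ℂ = k s t a := by
  classical
  let form : (T →₀ A) → (T →₀ A) → ℂ := fun x y =>
    x.sum fun s a => y.sum fun t b => k s t (star a * b)
  have form_single : ∀ s t a b, form (Finsupp.single s a) (Finsupp.single t b) =
      k s t (star a * b) := fun s t a b => by simp [form]
  have form_symm : ∀ x y, star (form y x) = form x y := fun x y => by
    simp only [form, Finsupp.sum, star_sum]
    rw [Finset.sum_comm]
    refine Finset.sum_congr rfl fun s _ => Finset.sum_congr rfl fun t _ => ?_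
    rw [← hsymm t s (star (x s) * y t), star_mul, star_star]
  let c : PreInnerProductSpace.Core ℂ (T →₀ A) :=
    { inner := form
      conj_inner_symm := form_symm
      re_inner_nonneg := fun x => hpos x.support x
      add_left := fun x y z => by
        simp only [form]
        refine Finsupp.sum_add_index' (by simp) fun t a b => ?_
        rw [← Finsupp.sum_add]
        simp only [star_add, add_mul, map_add]
      smul_left := fun x y r => by
        simp only [form]
        rw [Finsupp.sum_smul_index' (by simp), Finsupp.mul_sum]
        simp only [Finsupp.mul_sum, star_smul, smul_mul_assoc, map_smul, smul_eq_mul]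
        rfl }
  let L : A →ₐ[ℂ] Module.End ℂ (T →₀ A) := Algebra.lsmul ℂ ℂ (T →₀ A)
  have hL : ∀ a x, L a x = a • x := fun _ _ => rfl
  have hadj : ∀ (a : A) x y, form (star a • x) y = form x (a • y) := fun a x y => by
    refine (Finsupp.sum_smul_index' fun s => by simp).trans ?_
    refine Finsupp.sum_congr fun s _ => ?_
    refine Eq.trans ?_ (Finsupp.sum_smul_index' fun t => by simp).symm
    simp only [smul_eq_mul, star_mul, star_star, mul_assoc]
  have form_add_right : ∀ x y z, form x (y + z) = form x y + form x z := fun x y z => by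
    rw [← form_symm, ← form_symm x y, ← form_symm x z, ← star_add]
    exact congrArg star (c.add_left y z x)
  have form_smul_right : ∀ x y (r : ℂ), form x (r • y) = r * form x y := fun x y r => by
    rw [← form_symm, ← form_symm x y]
    refine (congrArg star (c.smul_left y x r)).trans ?_
    rw [star_mul', starRingEnd_apply, star_star]
    rfl
  have hbd : ∀ a, ∃ C : ℝ, ∀ x, (form (L a x) (L a x)).re ≤ C ^ 2 * (form x x).re := fun a => by
    let _ : PartialOrder A := CStarAlgebra.spectralOrder A
    have _ : StarOrderedRing A := CStarAlgebra.spectralOrderedRing A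
    -- Boundedness of the action: writing `‖a‖² - star a * a = star d * d`, the value of the form at
    -- `a • x` falls short of `‖a‖²` times its value at `x` by its value at `d • x`, which is
    -- nonnegative.
    have h1 : 0 ≤ algebraMap ℝ A (‖a‖ ^ 2) - star a * a := by
      rw [sub_nonneg, sq, ← CStarRing.norm_star_mul_self]
      exact (IsSelfAdjoint.star_mul_self a).le_algebraMap_norm_self
    obtain ⟨d, hd⟩ := exists_eq_star_mul_self_of_nonneg h1
    refine ⟨‖a‖, fun x => ?_⟩
    have h2 : form (a • x) (a • x) + form (d • x) (d • x) = ((‖a‖ ^ 2 : ℝ) : ℂ) * form x x := by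
      rw [← star_star a, hadj, star_star, ← star_star d, hadj, star_star, ← form_add_right,
        smul_smul, smul_smul, ← add_smul, ← hd, add_sub_cancel, ← form_smul_right]
      congr 1
      rw [IsScalarTower.algebraMap_apply ℝ ℂ A, algebraMap_smul]
      rfl
    have h3 : 0 ≤ (form (d • x) (d • x)).re := c.re_inner_nonneg (d • x)
    have h4 := congrArg Complex.re h2
    rw [Complex.add_re, Complex.re_ofReal_mul] at h4
    rw [hL]
    linarith
  obtain ⟨K, i1, i2, i3, π, ι, hι, hin, hπ⟩ := exists_rep_of_preInner c L hadj hbd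
  have hsing : ∀ a t, π a (ι (Finsupp.single t 1)) = ι (Finsupp.single t a) := fun a t => by
    rw [hπ, hL, Finsupp.smul_single, smul_eq_mul, mul_one]
  refine ⟨K, i1, i2, i3, π, fun t => ι (Finsupp.single t 1), ?_, fun s t a => ?_⟩
  · refine Dense.mono ?_ hι
    rintro _ ⟨x, rfl⟩
    induction x using Finsupp.induction_linear with
    | zero => rw [map_zero]; exact Submodule.zero_mem _
    | add x y hx hy => rw [map_add]; exact Submodule.add_mem _ hx hy
    | single t a => exact Submodule.subset_span ⟨(a, t), hsing a t⟩
  · rw [hsing, hin]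
    change form _ _ = _
    rw [form_single, star_one, one_mul]

/-! ### The enlarged Stinespring kernel -/

section Dilation

variable {A H J : Type*} [CStarAlgebra A] [PartialOrder A] [StarOrderedRing A]
  [NormedAddCommGroup H] [InnerProductSpace ℂ H] [CompleteSpace H]

theorem CompletelyPositiveMap.map_star_eq (Φ : A →CP (H →L[ℂ] H)) (a : A) :
    Φ (star a) = star (Φ a) :=
  map_star (PositiveLinearMap.ofClass Φ) a

open Classical in
/-- The kernel of the direct sum of the Stinespring dilation of `Φ` and of the cyclic
representations of all positive functionals, each repeated `J` times. -/
noncomputable def dilationKernel (Φ : A →CP (H →L[ℂ] H)) :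
    H ⊕ (J × PosFunctional A) → H ⊕ (J × PosFunctional A) → A →ₗ[ℂ] ℂ
  | .inl h, .inl h' =>
    { toFun := fun a => ⟪h, Φ a h'⟫_ℂ
      map_add' := fun a b => by rw [map_add, add_apply, inner_add_right]
      map_smul' := fun c a => by rw [map_smul, smul_apply, inner_smul_right]; rfl }
  | .inr p, .inr q => if p = q then p.2.1 else 0
  | .inl _, .inr _ => 0
  | .inr _, .inl _ => 0

@[simp]
theorem dilationKernel_inl_inl (Φ : A →CP (H →L[ℂ] H)) (h h' : H) (a : A) :
    dilationKernel (J := J) Φ (.inl h) (.inl h') a = ⟪h, Φ a h'⟫_ℂ := rfl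

@[simp]
theorem dilationKernel_inl_inr (Φ : A →CP (H →L[ℂ] H)) (h : H) (p : J × PosFunctional A) (a : A) :
    dilationKernel Φ (.inl h) (.inr p) a = 0 := rfl

@[simp]
theorem dilationKernel_inr_inl (Φ : A →CP (H →L[ℂ] H)) (h : H) (p : J × PosFunctional A) (a : A) :
    dilationKernel Φ (.inr p) (.inl h) a = 0 := rfl

open Classical in
theorem dilationKernel_inr_inr (Φ : A →CP (H →L[ℂ] H)) (p q : J × PosFunctional A) (a : A) :
    dilationKernel Φ (.inr p) (.inr q) a = if p = q then p.2.1 a else 0 := by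
  simp only [dilationKernel]
  split_ifs <;> rfl

theorem dilationKernel_symm (Φ : A →CP (H →L[ℂ] H)) (s t : H ⊕ (J × PosFunctional A)) (a : A) :
    star (dilationKernel Φ s t (star a)) = dilationKernel Φ t s a := by
  classical
  rcases s with h | p <;> rcases t with h' | q
  · rw [dilationKernel_inl_inl, dilationKernel_inl_inl, Φ.map_star_eq,
      ContinuousLinearMap.star_eq_adjoint, ContinuousLinearMap.adjoint_inner_right]
    exact inner_conj_symm _ _
  · simp
  · simp
  · simp only [dilationKernel_inr_inr]
    by_cases hpq : p = q
    · subst hpq; simp [PosFunctional.apply_star]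
    · simp [hpq, Ne.symm hpq]

/-- The kernel is block diagonal: complete positivity handles the `H` block, and the other block is
diagonal with positive functionals on the diagonal. -/
theorem dilationKernel_nonneg (Φ : A →CP (H →L[ℂ] H)) (F : Finset (H ⊕ (J × PosFunctional A)))
    (a : H ⊕ (J × PosFunctional A) → A) :
    0 ≤ (∑ s ∈ F, ∑ t ∈ F, dilationKernel Φ s t (star (a s) * a t)).re := by
  classical
  rw [← Finset.toLeft_disjSum_toRight (u := F)]
  simp only [Finset.sum_disjSum, dilationKernel_inl_inl, dilationKernel_inl_inr,
    dilationKernel_inr_inl, dilationKernel_inr_inr, Finset.sum_const_zero, add_zero, zero_add,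
    Complex.add_re]
  refine add_nonneg ?_ ?_
  · have := Φ.sum_inner_nonneg (fun s : F.toLeft => a (.inl s)) (fun s : F.toLeft => (s : H))
    rw [← Finset.sum_coe_sort]
    simp only [← Finset.sum_coe_sort F.toLeft]
    exact this
  · rw [Complex.re_sum]
    refine Finset.sum_nonneg fun p hp => ?_
    rw [Finset.sum_ite_eq, if_pos hp]
    exact (Complex.le_def.mp (p.2.2 _)).1

end Dilation

/-! ### Cyclic decompositions and embeddings over `B` -/

section Comparison

variable {X Y : Type*} [NormedAddCommGroup X] [InnerProductSpace ℂ X] [CompleteSpace X]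
  [NormedAddCommGroup Y] [InnerProductSpace ℂ Y] [CompleteSpace Y]

theorem StarAlgHom.inner_apply_left {A : Type*} [Ring A] [StarRing A] [Algebra ℂ A]
    (π : A →⋆ₐ[ℂ] (X →L[ℂ] X)) (a : A) (x y : X) : ⟪π a x, y⟫_ℂ = ⟪x, π (star a) y⟫_ℂ := by
  rw [map_star, ContinuousLinearMap.star_eq_adjoint, ContinuousLinearMap.adjoint_inner_right]

theorem StarAlgHom.apply_mul_apply {A : Type*} [Ring A] [StarRing A] [Algebra ℂ A]
    (π : A →⋆ₐ[ℂ] (X →L[ℂ] X)) (a b : A) (x : X) : π (a * b) x = π a (π b x) := by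
  rw [map_mul]; rfl

theorem StarAlgHom.inner_apply_apply {A : Type*} [Ring A] [StarRing A] [Algebra ℂ A]
    (π : A →⋆ₐ[ℂ] (X →L[ℂ] X)) (a b : A) (x y : X) :
    ⟪π a x, π b y⟫_ℂ = ⟪x, π (star a * b) y⟫_ℂ := by
  rw [π.inner_apply_left, π.apply_mul_apply]

/-- An orthonormal family is not larger than a total infinite one. -/
theorem Orthonormal.exists_injective_prod_nat {S Λ : Type*} {v : S → X} (hv : Orthonormal ℂ v)
    {u : Λ → X} (hu : Dense (Submodule.span ℂ (Set.range u) : Set X)) :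
    ∃ e : S → Λ × ℕ, Function.Injective e := by
  have h1 : ∀ s, ∃ l, ⟪v s, u l⟫_ℂ ≠ 0 := fun s => by
    by_contra! h
    have h2 : v s ∈ (Submodule.span ℂ (Set.range u))ᗮ := by
      rw [Submodule.mem_orthogonal']
      intro x hx
      induction hx using Submodule.span_induction with
      | mem x hx => obtain ⟨l, rfl⟩ := hx; exact h l
      | zero => exact inner_zero_right _
      | add x y _ _ hx hy => rw [inner_add_right, hx, hy, add_zero]
      | smul c x _ hx => rw [inner_smul_right, hx, mul_zero]
    rw [(Submodule.topologicalClosure_eq_top_iff).mp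
      (Submodule.dense_iff_topologicalClosure_eq_top.mp hu), Submodule.mem_bot] at h2
    exact hv.ne_zero s h2
  choose l hl using h1
  -- By Bessel's inequality each `u m` meets only countably many `v s` nontrivially. So the index
  -- set is a union, over `Λ`, of countable sets.
  have h3 : ∀ m, {s | ⟪v s, u m⟫_ℂ ≠ 0}.Countable := fun m => by
    refine ((hv.inner_products_summable (x := u m)).countable_support).mono fun s hs => ?_
    simpa using hs
  have h4 : ∀ m, ∃ g : S → ℕ, Set.InjOn g {s | ⟪v s, u m⟫_ℂ ≠ 0} := fun m =>
    Set.countable_iff_exists_injOn.mp (h3 m)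
  choose g hg using h4
  refine ⟨fun s => (l s, g (l s) s), fun s t hst => ?_⟩
  obtain ⟨h5, h6⟩ := Prod.mk.inj hst
  refine hg (l s) (hl s) ?_ ?_
  · change ⟪v t, u (l s)⟫_ℂ ≠ 0
    rw [h5]; exact hl t
  · rw [h6, h5]

/-- Decomposition of a representation into cyclic ones, relative to given vectors. -/
theorem StarAlgHom.exists_cyclic_decomposition {B Λ : Type*} [Ring B] [StarRing B] [Algebra ℂ B]
    (σ : B →⋆ₐ[ℂ] (X →L[ℂ] X)) (j : Λ → X) :
    ∃ S : Set X, Orthonormal ℂ (Subtype.val : S → X) ∧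
      (∀ s ∈ S, ∀ l b, ⟪j l, σ b s⟫_ℂ = 0) ∧
      (∀ s ∈ S, ∀ t ∈ S, s ≠ t → ∀ b, ⟪s, σ b t⟫_ℂ = 0) ∧
      Dense (Submodule.span ℂ (Set.range fun p : B × (Λ ⊕ S) =>
        σ p.1 (Sum.elim j Subtype.val p.2)) : Set X) := by
  let P : Set (Set X) := {S | (∀ s ∈ S, ‖s‖ = 1) ∧ (∀ s ∈ S, ∀ l b, ⟪j l, σ b s⟫_ℂ = 0) ∧
    ∀ s ∈ S, ∀ t ∈ S, s ≠ t → ∀ b, ⟪s, σ b t⟫_ℂ = 0}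
  obtain ⟨S, hS⟩ := zorn_subset P fun c hc hchain => by
    refine ⟨⋃₀ c, ⟨?_, ?_, ?_⟩, fun s => Set.subset_sUnion_of_mem⟩
    · rintro s ⟨C, hC, hs⟩; exact (hc hC).1 s hs
    · rintro s ⟨C, hC, hs⟩; exact (hc hC).2.1 s hs
    · rintro s ⟨C, hC, hs⟩ t ⟨D, hD, ht⟩
      rcases hchain.total hC hD with h | h
      · exact (hc hD).2.2 s (h hs) t ht
      · exact (hc hC).2.2 s hs t (h ht)
  obtain ⟨h1, h2, h3⟩ := hS.prop
  refine ⟨S, ⟨fun s => h1 s s.2, fun s t hst => ?_⟩, h2, h3, ?_⟩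
  · have := h3 s s.2 t t.2 (fun h => hst (Subtype.ext h)) 1
    simpa using this
  refine dense_span_of_forall_inner_eq_zero fun x hx => ?_
  by_contra hx0
  have hj : ∀ l b, ⟪j l, σ b x⟫_ℂ = 0 := fun l b => by
    rw [← star_star b, ← σ.inner_apply_left]
    exact hx _ ⟨(star b, .inl l), rfl⟩
  have hs : ∀ s ∈ S, ∀ b, ⟪s, σ b x⟫_ℂ = 0 := fun s hs b => by
    rw [← star_star b, ← σ.inner_apply_left]
    exact hx _ ⟨(star b, .inr ⟨s, hs⟩), rfl⟩
  have hs' : ∀ s ∈ S, ∀ b, ⟪x, σ b s⟫_ℂ = 0 := fun s hsS b => by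
    rw [← star_star b, ← σ.inner_apply_left, ← inner_conj_symm, hs s hsS, map_zero]
  -- A vector orthogonal to all the cyclic pieces could be normalized and added to `S`. By
  -- maximality it already belongs to `S`, and is then orthogonal to itself.
  let y : X := ((‖x‖ : ℂ)⁻¹) • x
  have hy : ‖y‖ = 1 := norm_smul_inv_norm hx0
  have hmem : insert y S ∈ P := by
    refine ⟨?_, ?_, ?_⟩
    · rintro s (rfl | hs)
      exacts [hy, h1 s hs]
    · rintro s (rfl | hs) l b
      · rw [map_smul, inner_smul_right, hj, mul_zero]
      · exact h2 s hs l b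
    · rintro s (rfl | hsS) t (rfl | htS) hst b
      · exact absurd rfl hst
      · rw [inner_smul_left, hs' t htS, mul_zero]
      · rw [map_smul, inner_smul_right, hs s hsS, mul_zero]
      · exact h3 s hsS t htS hst b
  have hyS : y ∈ S := hS.le_of_ge hmem (Set.subset_insert _ _) (Set.mem_insert _ _)
  have h5 := hs y hyS 1
  rw [map_one, one_apply_eq_self, inner_smul_left] at h5
  have h6 : ⟪x, x⟫_ℂ = 0 := by
    refine (mul_eq_zero.mp h5).resolve_left ?_
    simpa using hx0
  exact hx0 (inner_self_eq_zero.mp h6)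

/-- A vector functional of a representation. -/
noncomputable def StarAlgHom.vectorFunctional {B : Type*} [Ring B] [StarRing B] [Algebra ℂ B]
    (σ : B →⋆ₐ[ℂ] (X →L[ℂ] X)) (x : X) : PosFunctional B :=
  ⟨{ toFun := fun b => ⟪x, σ b x⟫_ℂ
     map_add' := fun a b => by rw [map_add, add_apply, inner_add_right]
     map_smul' := fun c a => by rw [map_smul, smul_apply, inner_smul_right]; rfl }, fun a => by
    change 0 ≤ ⟪x, σ (star a * a) x⟫_ℂ
    rw [← σ.inner_apply_apply]
    exact Complex.le_def.mpr ⟨inner_self_nonneg (𝕜 := ℂ), (inner_self_im (𝕜 := ℂ) _).symm⟩⟩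

/-- A representation of `A` restricted to `B` embeds in the restriction to `B` of any
representation of another C⋆-algebra `A'` containing sufficiently many copies of all cyclic
representations of `A'`. -/
theorem exists_linearIsometry_of_cyclic_copies {A A' B T Λ J : Type*} [CStarAlgebra A]
    [CStarAlgebra A'] [CStarAlgebra B] (f : B →⋆ₐ[ℂ] A) (f' : B →⋆ₐ[ℂ] A')
    (hf' : Function.Injective f') (π : A →⋆ₐ[ℂ] (X →L[ℂ] X)) (π' : A' →⋆ₐ[ℂ] (Y →L[ℂ] Y))
    {ξ : T → X} (hξ : Dense (Submodule.span ℂ (Set.range fun p : A × T => π p.1 (ξ p.2)) : Set X))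
    {j : Λ → X} {j' : Λ → Y} {η : J × PosFunctional A' → Y}
    (hj : ∀ l l' b, ⟪j l, π (f b) (j l')⟫_ℂ = ⟪j' l, π' (f' b) (j' l')⟫_ℂ)
    (hjη : ∀ l p a, ⟪j' l, π' a (η p)⟫_ℂ = 0)
    (hη : ∀ p a, ⟪η p, π' a (η p)⟫_ℂ = p.2.1 a)
    (hηη : ∀ p q a, p ≠ q → ⟪η p, π' a (η q)⟫_ℂ = 0)
    {e : (A × T) × ℕ → J} (he : Function.Injective e) :
    ∃ V : X →ₗᵢ[ℂ] Y, (∀ b x, V (π (f b) x) = π' (f' b) (V x)) ∧ ∀ l, V (j l) = j' l := by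
  let σ := π.comp f
  let σ' := π'.comp f'
  obtain ⟨S, hS, hjS, hSS, hdense⟩ := σ.exists_cyclic_decomposition j
  obtain ⟨g, hg⟩ := hS.exists_injective_prod_nat hξ
  -- The vector functional of each generator, extended from `B` to `A'`, names the cyclic summand of
  -- `Y` that will receive its piece. The first coordinate of `q` keeps these summands distinct even
  -- when functionals coincide.
  choose ψ hψ using fun s : S => (σ.vectorFunctional (s : X)).exists_extension f' hf'
  let q : S → J × PosFunctional A' := fun s => (e (g s), ψ s)
  have hq : ∀ s t, s ≠ t → q s ≠ q t := fun s t hst h => hst (hg (he (Prod.mk.inj h).1))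
  let u : Λ ⊕ S → X := Sum.elim j Subtype.val
  let u' : Λ ⊕ S → Y := Sum.elim j' fun s => η (q s)
  have hjη' : ∀ l p a, ⟪η p, π' a (j' l)⟫_ℂ = 0 := fun l p a => by
    rw [← star_star a, ← π'.inner_apply_left, ← inner_conj_symm, hjη, map_zero]
  have hjS' : ∀ s ∈ S, ∀ l b, ⟪s, σ b (j l)⟫_ℂ = 0 := fun s hs l b => by
    rw [← star_star b, ← σ.inner_apply_left, ← inner_conj_symm, hjS s hs, map_zero]
  have hgram : ∀ s t b, ⟪u s, σ b (u t)⟫_ℂ = ⟪u' s, σ' b (u' t)⟫_ℂ := by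
    rintro (l | s) (l' | t) b
    · exact hj l l' b
    · exact (hjS t t.2 l b).trans (hjη l (q t) (f' b)).symm
    · exact (hjS' s s.2 l' b).trans (hjη' l' (q s) (f' b)).symm
    · by_cases hst : s = t
      · subst hst
        exact (hψ s b).symm.trans (hη (q s) (f' b)).symm
      · exact (hSS s s.2 t t.2 (fun h => hst (Subtype.ext h)) b).trans
          (hηη (q s) (q t) (f' b) (hq s t hst)).symm
  obtain ⟨V, hV⟩ := exists_linearIsometry_of_gram (w := fun p : B × (Λ ⊕ S) => σ' p.1 (u' p.2))
    hdense fun a b => by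
      rw [σ.inner_apply_apply, σ'.inner_apply_apply]
      exact hgram _ _ _
  have hV' : ∀ b t, V (σ b (u t)) = σ' b (u' t) := fun b t => hV (b, t)
  refine ⟨V, fun b => ?_, fun l => ?_⟩
  · have : V.toContinuousLinearMap ∘L σ b = σ' b ∘L V.toContinuousLinearMap := by
      refine ContinuousLinearMap.ext_on hdense ?_
      rintro _ ⟨⟨c, t⟩, rfl⟩
      change V (σ b (σ c (u t))) = σ' b (V (σ c (u t)))
      rw [hV', ← σ.apply_mul_apply, hV', σ'.apply_mul_apply]
    exact fun x => DFunLike.congr_fun this x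
  · have := hV' 1 (.inl l)
    rwa [map_one, map_one] at this

end Comparison

/-! ### Universal properties of the free product -/

namespace AmalgFree

variable {I : Type*} {B : Type*} {A : I → Type*} [CStarAlgebra B] [∀ i, CStarAlgebra (A i)]
  {ε : ∀ i, B →⋆ₐ[ℂ] A i}

/-- The universal property of the `*`-algebraic amalgamated free product. -/
theorem AlgProd.exists_lift {D : Type*} [Ring D] [StarRing D] [Algebra ℂ D] [StarModule ℂ D]
    (π : ∀ i, A i →⋆ₐ[ℂ] D) (hπ : ∀ i j b, π i (ε i b) = π j (ε j b)) :
    ∃ ρ : AlgProd ε →⋆ₐ[ℂ] D, ∀ i a, ρ (AlgProd.incl ε i a) = π i a := by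
  let f : FreeAlgebra ℂ (Σ i, A i) →ₐ[ℂ] D := FreeAlgebra.lift ℂ fun s => π s.1 s.2
  have hf : ∀ i a, f (FreeAlgebra.ι ℂ ⟨i, a⟩) = π i a := fun i a => FreeAlgebra.lift_ι_apply _ _
  have hrel : ∀ ⦃x y⦄, Rel ε x y → f x = f y := by
    intro x y h
    induction h with
    | add i a b => simp [hf]
    | mul i a b => simp [hf]
    | scalar i c => rw [hf, AlgHom.commutes]; exact AlgHomClass.commutes (π i) c
    | amalg i j b => rw [hf, hf, hπ i j]
  let g : AlgProd ε →ₐ[ℂ] D := RingQuot.liftAlgHom ℂ ⟨f, hrel⟩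
  have hg : ∀ i a, g (AlgProd.inclAlg ε i a) = π i a := fun i a =>
    (RingQuot.liftAlgHom_mkAlgHom_apply ℂ f hrel _).trans (hf i a)
  refine ⟨{ g with map_star' := fun x => ?_ }, hg⟩
  change g (star x) = star (g x)
  induction x using AlgProd.induction with
  | scalar c => rw [AlgProd.star_algebraMap, AlgHom.commutes, AlgHom.commutes, algebraMap_star_comm]
  | incl i a => rw [AlgProd.star_incl, hg, hg, map_star]
  | add x y hx hy => rw [star_add, map_add, map_add, star_add, hx, hy]
  | mul x y hx hy => rw [star_mul, map_mul, map_mul, star_mul, hx, hy]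

variable {K : Type*} [NormedAddCommGroup K] [InnerProductSpace ℂ K] [CompleteSpace K]

/-- Representations on Hilbert spaces in any universe are contractive for the maximal seminorm. -/
theorem AlgProd.norm_apply_le (ρ : AlgProd ε →⋆ₐ[ℂ] (K →L[ℂ] K)) (x : AlgProd ε) :
    ‖ρ x‖ ≤ ‖x‖ := by
  refine ContinuousLinearMap.opNorm_le_bound _ (norm_nonneg _) fun ζ => ?_
  -- The cyclic subspace of `ζ` is rebuilt as a completion of `AlgProd ε` itself. It thus lies in
  -- the universe over which the seminorm takes its supremum, and `‖ρ x ζ‖` is the norm of `π x`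
  -- applied to the class of `1`.
  let c : PreInnerProductSpace.Core ℂ (AlgProd ε) :=
    { inner := fun y z => ⟪ρ y ζ, ρ z ζ⟫_ℂ
      conj_inner_symm := fun y z => inner_conj_symm _ _
      re_inner_nonneg := fun y => inner_self_nonneg
      add_left := fun y z w => by rw [map_add, add_apply, inner_add_left]
      smul_left := fun y z r => by rw [map_smul, smul_apply, inner_smul_left] }
  have hc : ∀ y z, c.inner y z = ⟪ρ y ζ, ρ z ζ⟫_ℂ := fun _ _ => rfl
  have hre : ∀ y, (c.inner y y).re = ‖ρ y ζ‖ ^ 2 := fun y => inner_self_eq_norm_sq (𝕜 := ℂ) _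
  have hL : ∀ y z, Algebra.lmul ℂ (AlgProd ε) y z = y * z := fun _ _ => rfl
  obtain ⟨G, i1, i2, i3, π, ι, -, hι, hπ⟩ := exists_rep_of_preInner c
    (Algebra.lmul ℂ (AlgProd ε))
    (fun a y z => by
      rw [hc, hc, hL, hL, ρ.apply_mul_apply, ρ.apply_mul_apply, ρ.inner_apply_left, star_star])
    (fun a => ⟨‖ρ a‖, fun y => by
      rw [hre, hre, hL, ρ.apply_mul_apply, ← mul_pow]
      exact pow_le_pow_left₀ (norm_nonneg _) ((ρ a).le_opNorm _) 2⟩)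
  have hnorm : ∀ y, ‖ι y‖ = ‖ρ y ζ‖ := fun y => by
    rw [@norm_eq_sqrt_re_inner ℂ, @norm_eq_sqrt_re_inner ℂ, hι, hc]
  have h1 : ‖π x (ι 1)‖ = ‖ρ x ζ‖ := by rw [hπ, hnorm, hL, mul_one]
  have h2 : ‖ι 1‖ = ‖ζ‖ := by rw [hnorm, map_one, one_apply_eq_self]
  rw [← h1, ← h2]
  refine ((π x).le_opNorm _).trans (mul_le_mul_of_nonneg_right ?_ (norm_nonneg _))
  exact AlgProd.le_maxNorm ⟨G, π⟩ x

/-- The universal property of the amalgamated free product for representations. -/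
theorem FreeProd.exists_lift (π : ∀ i, A i →⋆ₐ[ℂ] (K →L[ℂ] K))
    (hπ : ∀ i j b, π i (ε i b) = π j (ε j b)) :
    ∃ ρ : FreeProd ε →⋆ₐ[ℂ] (K →L[ℂ] K), ∀ i a, ρ (FreeProd.incl ε i a) = π i a := by
  obtain ⟨ρ, hρ⟩ := AlgProd.exists_lift π hπ
  have hcont : Continuous ρ :=
    AddMonoidHomClass.continuous_of_bound ρ 1 fun x => by
      rw [one_mul]; exact AlgProd.norm_apply_le ρ x
  let g : FreeProd ε →+* (K →L[ℂ] K) := Completion.extensionHom (ρ : AlgProd ε →+* (K →L[ℂ] K)) hcont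
  have hg : ∀ x, g (FreeProd.ofAlg ε x) = ρ x := fun x => Completion.extensionHom_coe _ hcont x
  have hgc : Continuous g := Completion.continuous_extension
  refine ⟨{ g with
    commutes' := fun r => ?_
    map_star' := fun x => ?_ }, fun i a => (hg _).trans (hρ i a)⟩
  · change g (algebraMap ℂ (FreeProd ε) r) = _
    rw [← (FreeProd.ofAlg ε).commutes, hg]
    exact AlgHomClass.commutes ρ r
  · change g (star x) = star (g x)
    have hc := FreeProd.continuous_star' ε
    induction x using FreeProd.induction with
    | hp => exact isClosed_eq (hgc.comp hc) (by fun_prop)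
    | h x => rw [FreeProd.star_ofAlg, hg, hg, map_star]

end AmalgFree

/-! ### Compression, common dilation and conclusion -/

/-- The compression of a representation is completely positive. -/
theorem StarAlgHom.exists_compression {A H K : Type*} [CStarAlgebra A] [PartialOrder A]
    [StarOrderedRing A] [NormedAddCommGroup H] [InnerProductSpace ℂ H] [CompleteSpace H]
    [NormedAddCommGroup K] [InnerProductSpace ℂ K] [CompleteSpace K]
    (π : A →⋆ₐ[ℂ] (K →L[ℂ] K)) (V : H →L[ℂ] K) :
    ∃ Ψ : A →CP (H →L[ℂ] H), ∀ a x y, ⟪x, Ψ a y⟫_ℂ = ⟪V x, π a (V y)⟫_ℂ := by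
  let ψ : A →ₗ[ℂ] (H →L[ℂ] H) :=
    { toFun := fun a => ContinuousLinearMap.adjoint V ∘L (π a ∘L V)
      map_add' := fun a b => by ext x; simp
      map_smul' := fun c a => by ext x; simp }
  have hψ : ∀ a x y, ⟪x, ψ a y⟫_ℂ = ⟪V x, π a (V y)⟫_ℂ := fun a x y =>
    ContinuousLinearMap.adjoint_inner_right V x (π a (V y))
  have hstar : ∀ a, ψ (star a) = star (ψ a) := fun a => by
    rw [ContinuousLinearMap.star_eq_adjoint, ContinuousLinearMap.eq_adjoint_iff]
    intro x y
    rw [hψ, ← inner_conj_symm, hψ, inner_conj_symm, π.inner_apply_left, star_star]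
  refine ⟨⟨ψ, fun k M hM => ?_⟩, hψ⟩
  refine CStarMatrix.nonneg_of_sum_inner_nonneg _ ?_ fun h => ?_
  · ext s t
    have hM' : star (M t s) = M s t := by
      rw [← CStarMatrix.star_apply, hM.isSelfAdjoint.star_eq]
    rw [CStarMatrix.star_apply, CStarMatrix.map_apply, CStarMatrix.map_apply, ← hM', hstar]
  -- For `M = star N * N` the form is the sum over `r` of `‖∑ s, π (N r s) (V (h s))‖²`.
  · obtain ⟨N, rfl⟩ := exists_eq_star_mul_self_of_nonneg hM
    have h1 : ∀ s t, ⟪h s, ψ ((star N * N) s t) (h t)⟫_ℂ =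
        ∑ r, ⟪π (N r s) (V (h s)), π (N r t) (V (h t))⟫_ℂ := fun s t => by
      rw [hψ, CStarMatrix.mul_apply, map_sum, sum_apply, inner_sum]
      exact Finset.sum_congr rfl fun r _ => by
        rw [CStarMatrix.star_apply, π.inner_apply_apply]
    have h2 : ∑ s, ⟪h s, ((star N * N).map ψ).actVec h s⟫_ℂ =
        ∑ r, ⟪∑ s, π (N r s) (V (h s)), ∑ t, π (N r t) (V (h t))⟫_ℂ := by
      simp only [CStarMatrix.actVec, inner_sum, CStarMatrix.map_apply, h1, sum_inner]
      rw [Finset.sum_congr rfl fun _ _ => Finset.sum_comm, Finset.sum_comm]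
      exact Finset.sum_congr rfl fun _ _ => Finset.sum_comm
    rw [h2, Complex.re_sum]
    exact Finset.sum_nonneg fun r _ => inner_self_nonneg (𝕜 := ℂ)

/-- Unital completely positive maps agreeing on `B` have dilations agreeing on `B`. -/
theorem exists_common_dilation {I : Type vI} {B : Type*} {H : Type vH} {A : I → Type vA}
    [Nonempty I] [CStarAlgebra B]
    [∀ i, CStarAlgebra (A i)] [∀ i, PartialOrder (A i)] [∀ i, StarOrderedRing (A i)]
    (ε : ∀ i, B →⋆ₐ[ℂ] A i) (hε : ∀ i, Function.Injective (ε i))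
    [NormedAddCommGroup H] [InnerProductSpace ℂ H] [CompleteSpace H]
    (Φ : ∀ i, A i →CP (H →L[ℂ] H)) (hΦ_one : ∀ i, Φ i 1 = 1)
    (hΦ_agree : ∀ i j b, Φ i (ε i b) = Φ j (ε j b)) :
    ∃ (K : Type (max vI vH vA)) (_ : NormedAddCommGroup K) (_ : InnerProductSpace ℂ K) (_ : CompleteSpace K)
      (π : ∀ i, A i →⋆ₐ[ℂ] (K →L[ℂ] K)) (V : H →ₗᵢ[ℂ] K),
      (∀ i j b, π i (ε i b) = π j (ε j b)) ∧
      ∀ i a x y, ⟪V x, π i a (V y)⟫_ℂ = ⟪x, Φ i a y⟫_ℂ := by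
  -- `J` must bound the size of total families in the spaces `X i`, which are themselves built from
  -- `J`. Lists solve this circular requirement: `e` codes `(a, h, n)` as `[n, a, h]` and `(a, (l,
  -- φ), n)` as `n :: a :: φ :: l`, so the code of a datum containing a list is again a list.
  let J := List (ℕ ⊕ H ⊕ (Σ i, A i) ⊕ (Σ i, PosFunctional (A i)))
  let e : ∀ i, (A i × (H ⊕ (J × PosFunctional (A i)))) × ℕ → J := fun i p =>
    .inl p.2 :: .inr (.inr (.inl ⟨i, p.1.1⟩)) ::
      p.1.2.elim (fun h => [.inr (.inl h)]) fun q => .inr (.inr (.inr ⟨i, q.2⟩)) :: q.1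
  have he : ∀ i, Function.Injective (e i) := by
    rintro i ⟨⟨a, h | ⟨l, φ⟩⟩, n⟩ ⟨⟨a', h' | ⟨l', φ'⟩⟩, n'⟩ heq <;>
      simp [e, J] at heq ⊢ <;> tauto
  choose X i1 i2 i3 ρ ξ hdense hξ using fun i => exists_rep_of_kernel
    (dilationKernel (J := J) (Φ i)) (dilationKernel_symm (Φ i)) (dilationKernel_nonneg (Φ i))
  have hembed : ∀ i k, ∃ V : X i →ₗᵢ[ℂ] X k, (∀ b x, V (ρ i (ε i b) x) = ρ k (ε k b) (V x)) ∧
      ∀ h, V (ξ i (.inl h)) = ξ k (.inl h) := fun i k =>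
    exists_linearIsometry_of_cyclic_copies (ε i) (ε k) (hε k) (ρ i) (ρ k) (hdense i)
      (j := fun h => ξ i (.inl h)) (j' := fun h => ξ k (.inl h)) (η := fun p => ξ k (.inr p))
      (fun h h' b => by
        rw [hξ, hξ, dilationKernel_inl_inl, dilationKernel_inl_inl, hΦ_agree i k])
      (fun h p a => by rw [hξ, dilationKernel_inl_inr])
      (fun p a => by rw [hξ, dilationKernel_inr_inr, if_pos rfl])
      (fun p q a hpq => by rw [hξ, dilationKernel_inr_inr, if_neg hpq]) (he i)
  obtain ⟨k⟩ := ‹Nonempty I›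
  have hequiv : ∀ i, ∃ U : X i ≃ₗᵢ[ℂ] X k, (∀ b x, U (ρ i (ε i b) x) = ρ k (ε k b) (U x)) ∧
      ∀ h, U (ξ i (.inl h)) = ξ k (.inl h) := fun i => by
    obtain ⟨V, hV, hVj⟩ := hembed i k
    obtain ⟨W, hW, hWj⟩ := hembed k i
    exact exists_linearIsometryEquiv_intertwining (σ := fun b => ρ i (ε i b))
      (τ := fun b => ρ k (ε k b))
      (fun b x y => by rw [StarAlgHom.inner_apply_left, ← map_star, star_star])
      (fun b x y => by rw [StarAlgHom.inner_apply_left, ← map_star]) V W hV hW hVj hWj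
  choose U hU hUj using hequiv
  -- Unitality makes the Gram matrix of the vectors `ξ k (.inl h)` the inner product of `H`;
  -- linearity in `h` is then automatic.
  obtain ⟨V, hV⟩ := exists_linearIsometry_of_inner (j := fun h : H => ξ k (.inl h)) fun x y => by
    have := hξ k (.inl x) (.inl y) 1
    rw [map_one, one_apply_eq_self, dilationKernel_inl_inl, hΦ_one, one_apply_eq_self] at this
    exact this
  -- Conjugation by `U i` carries `ρ i` to `X k`. The intertwining over `B` makes the results agree
  -- there, and fixing `H` preserves the compressions.
  let π : ∀ i, A i →⋆ₐ[ℂ] (X k →L[ℂ] X k) := fun i =>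
    ((U i).conjStarAlgEquiv : (X i →L[ℂ] X i) →⋆ₐ[ℂ] (X k →L[ℂ] X k)).comp (ρ i)
  have hπ : ∀ i a x, π i a x = U i (ρ i a ((U i).symm x)) := fun i a x => rfl
  refine ⟨X k, i1 k, i2 k, i3 k, π, V, fun i j b => ?_, fun i a x y => ?_⟩
  · have h1 : ∀ i, π i (ε i b) = ρ k (ε k b) := fun i => by
      ext x
      rw [hπ, hU, LinearIsometryEquiv.apply_symm_apply]
    rw [h1, h1]
  · rw [hV, hV, hπ, ← hUj i x, ← hUj i y, LinearIsometryEquiv.symm_apply_apply,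
      LinearIsometryEquiv.inner_map_map, hξ, dilationKernel_inl_inl]

/-- A common dilation of completely positive maps yields a completely positive map on the
amalgamated free product. -/
theorem AmalgFree.FreeProd.exists_cp_of_dilation {I B H K : Type*} {A : I → Type*} [CStarAlgebra B]
    [∀ i, CStarAlgebra (A i)] [∀ i, PartialOrder (A i)] [∀ i, StarOrderedRing (A i)]
    {ε : ∀ i, B →⋆ₐ[ℂ] A i}
    [NormedAddCommGroup H] [InnerProductSpace ℂ H] [CompleteSpace H]
    [NormedAddCommGroup K] [InnerProductSpace ℂ K] [CompleteSpace K]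
    {Φ : ∀ i, A i →CP (H →L[ℂ] H)} (π : ∀ i, A i →⋆ₐ[ℂ] (K →L[ℂ] K)) (V : H →ₗᵢ[ℂ] K)
    (hπ : ∀ i j b, π i (ε i b) = π j (ε j b))
    (hV : ∀ i a x y, ⟪V x, π i a (V y)⟫_ℂ = ⟪x, Φ i a y⟫_ℂ) :
    ∃ Ψ : AmalgFree.FreeProd ε →CP (H →L[ℂ] H),
      Ψ 1 = 1 ∧ ∀ i a, Ψ (AmalgFree.FreeProd.incl ε i a) = Φ i a := by
  obtain ⟨ρ, hρ⟩ := AmalgFree.FreeProd.exists_lift π hπ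
  obtain ⟨Ψ, hΨ⟩ := ρ.exists_compression V.toContinuousLinearMap
  refine ⟨Ψ, ?_, fun i a => ?_⟩
  · ext x
    refine ext_inner_left ℂ fun y => ?_
    rw [hΨ, map_one]
    exact V.inner_map_map y x
  · ext x
    refine ext_inner_left ℂ fun y => ?_
    rw [hΨ, hρ]
    exact hV i a y x

theorem theorem3p2 {I : Type*} {B : Type*} {A : I → Type*}
    [CStarAlgebra B] [∀ i, CStarAlgebra (A i)]
    [∀ i, PartialOrder (A i)] [∀ i, StarOrderedRing (A i)]
    (ε : ∀ i, B →⋆ₐ[ℂ] A i) (hε : ∀ i, Function.Injective (ε i))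
    {H : Type*} [NormedAddCommGroup H] [InnerProductSpace ℂ H] [CompleteSpace H]
    (Φ : ∀ i, A i →CP (H →L[ℂ] H)) (hΦ_one : ∀ i, Φ i 1 = 1)
    (hΦ_agree : ∀ i j b, Φ i (ε i b) = Φ j (ε j b)) :
    ∃ Ψ : AmalgFree.FreeProd ε →CP (H →L[ℂ] H),
      Ψ 1 = 1 ∧ ∀ i a, Ψ (AmalgFree.FreeProd.incl ε i a) = Φ i a := by
  rcases isEmpty_or_nonempty I with hI | hI
  -- With no factors there is no base index `k` to choose; the empty family on `H` itself is a
  -- common dilation.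
  · exact AmalgFree.FreeProd.exists_cp_of_dilation (fun i => isEmptyElim i)
      (LinearIsometry.id : H →ₗᵢ[ℂ] H) (fun i => isEmptyElim i) fun i => isEmptyElim i
  · obtain ⟨K, _, _, _, π, V, hπ, hV⟩ := exists_common_dilation ε hε Φ hΦ_one hΦ_agree
    exact AmalgFree.FreeProd.exists_cp_of_dilation π V hπ hV
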